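/- A *universe* is a set $\mathbf U$ such that (1) $x\in y\in\mathbf U$ implies $x\in\mathbf U$; (2) $x,y\in\mathbf U$ implies $\{x,y\}\in\mathbf U$; (3) $x\in\mathbf U$ implies that the power set of $x$ is in $\mathbf U$; (4) if $x\in\mathbf U$ and $f:x\to\mathbf U$ is a map, then $\bigcup_{i\in x}f(i)\in\mathbf U$; (5) $\omega\in\mathbf U$. A *$\mathbf U$-set* is a member of $\mathbf U$ and a *$\mathbf U$-class* is a subset of $\mathbf U$ (for collections of objects and morphisms both are understood up to bijection). A category is *$\mathbf U$-small* if its objects and its morphisms form $\mathbf U$-sets, and *locally $\mathbf U$-small* if its objects and its morphisms form $\mathbf U$-classes and each of its hom-sets is a $\mathbf U$-set. Let $\kappa$ be a regular cardinal in a universe $\mathbf U$. An object $A$ of a category $\mathcal C$ is *$(\kappa,\mathbf U)$-compact* if $\mathrm{Hom}_{\mathcal C}(A,-)$ preserves colimits for all $\mathbf U$-small $\kappa$-filtered diagrams; $\mathbf K_\kappa^{\mathbf U}(\mathcal C)$ is the full subcategory of such objects. A *$\kappa$-accessible $\mathbf U$-category* is a locally $\mathbf U$-small category $\mathcal C$ that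 has colimits for all $\mathbf U$-small $\kappa$-filtered diagrams and has a $\mathbf U$-set $\mathcal G$ of $(\kappa,\mathbf U)$-compact objects such that every object of $\mathcal C$ is the colimit of a $\mathbf U$-small $\kappa$-filtered diagram of objects in $\mathcal G$. It is a *locally $\kappa$-presentable $\mathbf U$-category* if moreover it has colimits for all $\mathbf U$-small diagrams. A functor $F:\mathcal C\to\mathcal D$ is *$(\kappa,\mathbf U)$-accessible* if $\mathcal C$ is a $\kappa$-accessible $\mathbf U$-category and $F$ preserves colimits for all $\mathbf U$-small $\kappa$-filtered diagrams. Let $\mathbf U\subseteq\mathbf U^+$ be universes and let $\kappa$ be a regular cardinal in $\mathbf U$. A *$(\kappa,\mathbf U,\mathbf U^+)$-accessible extension* is a $(\kappa,\mathbf U)$-accessible functor $i:\mathcal C\to\mathcal C^+$ such that $\mathcal C$ is a $\kappa$-accessible $\mathbf U$-category, $\mathcal C^+$ is a $\kappa$-accessible $\mathbf U^+$-category, $i$ sends $(\kappa,\mathbf U)$-compact objects of $\mathcal C$ to $(\kappa,\mathbf U^+)$-compact objects of $\mathcal C^+$, and the functor $\mathbf K_\kappa^{\mathbf U}(\mathcal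 C)\to\mathbf K_\kappa^{\mathbf U^+}(\mathcal C^+)$ so induced by $i$ is fully faithful and essentially surjective on objects. **Proposition.** Let $i:\mathcal C\to\mathcal C^+$ be a $(\kappa,\mathbf U,\mathbf U^+)$-accessible extension. (i) $\mathcal C$ is a locally $\kappa$-presentable $\mathbf U$-category if and only if $\mathcal C^+$ is a locally $\kappa$-presentable $\mathbf U^+$-category. (ii) The functor $i:\mathcal C\to\mathcal C^+$ is fully faithful. (iii) If $B:\mathcal J\to\mathcal C$ is any diagram (not necessarily $\mathbf U$-small) and $\mathcal C$ has a limit for $B$, then $i$ preserves this limit. -/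

import Mathlib

open CategoryTheory CategoryTheory.Limits

universe w v u v' u' v'' u''

namespace UniverseEnlargement

/-! ### Grothendieck universes -/

/-- A (Grothendieck) universe: a set `U` which is transitive, closed under pairs, power sets and
unions of families `(f i)_{i ∈ x}` with `x ∈ U` and all `f i ∈ U`, and which contains `ω`. -/
structure IsUniverse (U : ZFSet.{w}) : Prop where
  mem_trans : ∀ {x y : ZFSet.{w}}, x ∈ y → y ∈ U → x ∈ U
  pair_mem : ∀ {x y : ZFSet.{w}}, x ∈ U → y ∈ U → ({x, y} : ZFSet.{w}) ∈ U
  powerset_mem : ∀ {x : ZFSet.{w}}, x ∈ U → x.powerset ∈ U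
  iUnion_mem : ∀ {x : ZFSet.{w}}, x ∈ U → ∀ f : {i : ZFSet.{w} // i ∈ x} → ZFSet.{w},
    (∀ i, f i ∈ U) → ZFSet.iUnion f ∈ U
  omega_mem : ZFSet.omega ∈ U

/-! ### Sizes

The collections of objects and of morphisms of a category are types, so "is a `U`-set"
(respectively "is a `U`-class") is read up to bijection. -/

/-- `X` is (in bijection with) a `U`-set, i.e. a member of `U`. -/
def IsUSet (U : ZFSet.{w}) (X : Type u) : Prop :=
  ∃ x : ZFSet.{w}, x ∈ U ∧ Nonempty (X ≃ {y : ZFSet.{w} // y ∈ x})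

/-- `X` is (in bijection with) a `U`-class, i.e. a subset of `U`. -/
def IsUClass (U : ZFSet.{w}) (X : Type u) : Prop :=
  ∃ x : ZFSet.{w}, x ⊆ U ∧ Nonempty (X ≃ {y : ZFSet.{w} // y ∈ x})

/-- A `U`-small category: its sets of objects and of morphisms are `U`-sets. -/
structure IsUSmall (U : ZFSet.{w}) (J : Type u) [Category.{v} J] : Prop where
  obj : IsUSet U J
  mor : IsUSet U (Arrow J)

/-- A locally `U`-small category: its collections of objects and of morphisms are `U`-classes, and
all its hom-sets are `U`-sets. -/
structure IsLocallyUSmall (U : ZFSet.{w}) (C : Type u) [Category.{v} C] : Prop where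
  obj : IsUClass U C
  mor : IsUClass U (Arrow C)
  hom : ∀ X Y : C, IsUSet U (X ⟶ Y)

/-! ### Accessibility relative to a universe

Every `U`-small category is isomorphic to one whose objects and morphisms are types in `Type w`,
if `U : ZFSet.{w}`, so it suffices to let the indexing categories range over these. -/

section

variable (U : ZFSet.{w}) (κ : Cardinal.{w}) [Fact κ.IsRegular]

/-- `C` has colimits for all `U`-small `κ`-filtered diagrams. -/
def HasFilteredColimits (C : Type u) [Category.{v} C] : Prop :=
  ∀ (J : Type w) [SmallCategory J], IsUSmall U J → IsCardinalFiltered J κ →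
    HasColimitsOfShape J C

/-- `F` preserves colimits for all `U`-small `κ`-filtered diagrams. -/
def PreservesFilteredColimits {C : Type u} [Category.{v} C] {D : Type u'} [Category.{v'} D]
    (F : C ⥤ D) : Prop :=
  ∀ (J : Type w) [SmallCategory J], IsUSmall U J → IsCardinalFiltered J κ →
    PreservesColimitsOfShape J F

/-- The property of being a `(κ, U)`-compact object: `Hom(A, -)` preserves colimits for all
`U`-small `κ`-filtered diagrams. -/
def isCompact (C : Type u) [Category.{v} C] : ObjectProperty C :=
  fun A => PreservesFilteredColimits U κ (coyoneda.obj (Opposite.op A))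

/-- `C` is `U`-cocomplete: it has colimits for all `U`-small diagrams. -/
def IsUCocomplete (C : Type u) [Category.{v} C] : Prop :=
  ∀ (J : Type w) [SmallCategory J], IsUSmall U J → HasColimitsOfShape J C

/-- `C` is a `κ`-accessible `U`-category. -/
structure IsAccessibleUCategory (C : Type u) [Category.{v} C] : Prop where
  locallySmall : IsLocallyUSmall U C
  hasFilteredColimits : HasFilteredColimits U κ C
  exists_generator : ∃ G : ObjectProperty C, IsUSet U {X : C // G X} ∧
    (∀ X : C, G X → isCompact U κ C X) ∧
    ∀ B : C, ∃ (J : Type w) (_ : SmallCategory J), IsUSmall U J ∧ IsCardinalFiltered J κ ∧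
      G.colimitsOfShape J B

/-- `C` is a locally `κ`-presentable `U`-category. -/
structure IsLocallyPresentableUCategory (C : Type u) [Category.{v} C] : Prop where
  accessible : IsAccessibleUCategory U κ C
  cocomplete : IsUCocomplete U C

/-- `F` is a `(κ, U)`-accessible functor. -/
structure IsAccessibleFunctor {C : Type u} [Category.{v} C] {D : Type u'} [Category.{v'} D]
    (F : C ⥤ D) : Prop where
  source : IsAccessibleUCategory U κ C
  preserves : PreservesFilteredColimits U κ F

end

/-- The functor `K_κ^U(C) ⥤ K_κ^{U'}(C')` between the full subcategories of compact objects
induced by a functor that sends `(κ, U)`-compact objects to `(κ, U')`-compact objects. -/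
def compactFunctor (U U' : ZFSet.{w}) (κ : Cardinal.{w}) [Fact κ.IsRegular]
    {C : Type u} [Category.{v} C] {C' : Type u'} [Category.{v'} C'] (i : C ⥤ C')
    (h : ∀ X : C, isCompact U κ C X → isCompact U' κ C' (i.obj X)) :
    (isCompact U κ C).FullSubcategory ⥤ (isCompact U' κ C').FullSubcategory :=
  (isCompact U' κ C').lift ((isCompact U κ C).ι ⋙ i) (fun X => h X.obj X.property)

/-- `i` is a `(κ, U, U')`-accessible extension. -/
structure IsAccessibleExtension (U U' : ZFSet.{w}) (κ : Cardinal.{w}) [Fact κ.IsRegular]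
    {C : Type u} [Category.{v} C] {C' : Type u'} [Category.{v'} C'] (i : C ⥤ C') : Prop where
  accessibleFunctor : IsAccessibleFunctor U κ i
  source : IsAccessibleUCategory U κ C
  target : IsAccessibleUCategory U' κ C'
  map_compact : ∀ X : C, isCompact U κ C X → isCompact U' κ C' (i.obj X)
  full : (compactFunctor U U' κ i map_compact).Full
  faithful : (compactFunctor U U' κ i map_compact).Faithful
  essSurj : (compactFunctor U U' κ i map_compact).EssSurj

end UniverseEnlargement

/-! Everything is tested on compact objects. An object of an accessible category is the canonical
colimit of the compact objects over it: morphisms out of it are separated and constructed by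
compatible families on compacts (`IsGenerating.hom_ext`, `IsGenerating.exists_desc`). A map from a
compact `i X` into `i Y` factors through a compact stage of `Y`, so full faithfulness on compacts
spreads to all of `C`. Limits are preserved because test objects in `C'` may be taken compact, hence
in the essential image of `i`.

For presentability, the pivot is `HasColimitsOfCompacts`: colimits of compacts along shapes with
fewer than `κ` arrows. Its shapes depend on `κ` only, not on the universe, and it transfers in both
directions along the equivalence of compact objects. It gives all `U`-small colimits
(`IsAccessibleUCategory.isUCocomplete`): resolve a diagram by the generators over it, then build the
colimit of the resolution as a `κ`-filtered colimit of colimits over fewer than `κ` arrows. -/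

namespace UniverseEnlargement

/-! ### Closure properties of a universe and of its sets up to bijection. -/

section Sets

variable {U : ZFSet.{w}}

lemma IsUniverse.mem_of_subset (hU : IsUniverse U) {x y : ZFSet.{w}} (h : x ⊆ y) (hy : y ∈ U) :
    x ∈ U :=
  hU.mem_trans (ZFSet.mem_powerset.2 h) (hU.powerset_mem hy)

lemma IsUniverse.union_mem (hU : IsUniverse U) {x y : ZFSet.{w}} (hx : x ∈ U) (hy : y ∈ U) :
    x ∪ y ∈ U := by
  refine hU.mem_of_subset ?_ (hU.iUnion_mem (hU.pair_mem hx hy) (fun i => i.1) ?_)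
  · intro z hz
    rw [ZFSet.mem_iUnion]
    rcases ZFSet.mem_union.1 hz with h | h
    · exact ⟨⟨x, by simp⟩, h⟩
    · exact ⟨⟨y, by simp⟩, h⟩
  · rintro ⟨i, hi⟩
    rcases ZFSet.mem_pair.1 hi with rfl | rfl
    · exact hx
    · exact hy

/-- Kuratowski pairs from `x` and `y` lie in the double power set of `x ∪ y`. -/
lemma IsUniverse.prod_mem (hU : IsUniverse U) {x y : ZFSet.{w}} (hx : x ∈ U) (hy : y ∈ U) :
    x.prod y ∈ U :=
  hU.mem_of_subset (y := (x ∪ y).powerset.powerset) (fun z hz => by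
      obtain ⟨a, ha, b, hb, rfl⟩ := ZFSet.mem_prod.1 hz
      rw [ZFSet.mem_powerset]
      intro t ht
      rw [ZFSet.mem_powerset]
      intro s hs
      rw [ZFSet.mem_union]
      rcases ZFSet.mem_pair.1 ht with rfl | rfl
      · rw [ZFSet.mem_singleton] at hs
        exact Or.inl (hs ▸ ha)
      · rcases ZFSet.mem_pair.1 hs with rfl | rfl
        · exact Or.inl ha
        · exact Or.inr hb)
    (hU.powerset_mem (hU.powerset_mem (hU.union_mem hx hy)))

lemma IsUSet.mono {U' : ZFSet.{w}} (h : U ⊆ U') {X : Type u} (hX : IsUSet U X) : IsUSet U' X := by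
  obtain ⟨x, hx, e⟩ := hX
  exact ⟨x, h hx, e⟩

lemma IsUSet.small {X : Type u} (hX : IsUSet U X) : Small.{w} X := by
  obtain ⟨x, _, ⟨e⟩⟩ := hX
  exact small_of_injective e.injective

lemma IsUSet.of_injective (hU : IsUniverse U) {X : Type u} {Y : Type v} (hY : IsUSet U Y)
    (f : X → Y) (hf : Function.Injective f) : IsUSet U X := by
  obtain ⟨y, hy, ⟨e⟩⟩ := hY
  refine ⟨y.sep (fun z => ∃ a, (e (f a) : ZFSet) = z), hU.mem_of_subset ZFSet.sep_subset hy,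
    ⟨Equiv.ofBijective (fun a => ⟨e (f a), ZFSet.mem_sep.2 ⟨(e (f a)).2, a, rfl⟩⟩) ⟨?_, ?_⟩⟩⟩
  · intro a b h
    exact hf (e.injective (Subtype.ext (by simpa using h)))
  · rintro ⟨z, hz⟩
    obtain ⟨-, a, rfl⟩ := ZFSet.mem_sep.1 hz
    exact ⟨a, rfl⟩

lemma IsUSet.of_surjective (hU : IsUniverse U) {X : Type u} {Y : Type v} (hX : IsUSet U X)
    (f : X → Y) (hf : Function.Surjective f) : IsUSet U Y :=
  hX.of_injective hU (Function.surjInv hf) (Function.injective_surjInv hf)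

lemma IsUSet.sigma (hU : IsUniverse U) {X : Type u} {Y : X → Type v} (hX : IsUSet U X)
    (hY : ∀ a, IsUSet U (Y a)) : IsUSet U (Σ a, Y a) := by
  obtain ⟨x, hx, ⟨e⟩⟩ := hX
  choose y hy e' using hY
  -- Tagging each fibre with its index makes the union disjoint.
  let t : {i : ZFSet.{w} // i ∈ x} → ZFSet.{w} := fun i => ZFSet.prod {i.1} (y (e.symm i))
  have ht : ZFSet.iUnion t ∈ U := hU.iUnion_mem hx t (fun i => hU.prod_mem
    (by rw [← ZFSet.pair_eq_singleton]; exact hU.pair_mem (hU.mem_trans i.2 hx)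
          (hU.mem_trans i.2 hx)) (hy _))
  have hT : IsUSet U {z : ZFSet.{w} // z ∈ ZFSet.iUnion t} := ⟨_, ht, ⟨Equiv.refl _⟩⟩
  refine hT.of_injective hU (fun p => ⟨ZFSet.pair (e p.1) ((e' p.1).some p.2),
    ZFSet.mem_iUnion.2 ⟨e p.1, ?_⟩⟩) ?_
  · simp only [ZFSet.pair_mem_prod, Equiv.symm_apply_apply]
    exact ⟨by simp, Subtype.property _⟩
  · rintro ⟨a, b⟩ ⟨a', b'⟩ h
    obtain ⟨h₁, h₂⟩ := ZFSet.pair_inj.1 (congr_arg Subtype.val h)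
    obtain rfl : a = a' := e.injective (Subtype.ext h₁)
    obtain rfl : b = b' := (e' a).some.injective (Subtype.ext h₂)
    rfl

lemma IsUSet.prod (hU : IsUniverse U) {X : Type u} {Y : Type v} (hX : IsUSet U X)
    (hY : IsUSet U Y) : IsUSet U (X × Y) :=
  (IsUSet.sigma hU hX (fun _ => hY)).of_injective hU (fun p => ⟨p.1, p.2⟩) (by
    rintro ⟨a, b⟩ ⟨a', b'⟩ h
    simpa using h)

lemma IsUSet.set (hU : IsUniverse U) {X : Type u} (hX : IsUSet U X) : IsUSet U (Set X) := by
  obtain ⟨x, hx, ⟨e⟩⟩ := hX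
  have hT : IsUSet U {z : ZFSet.{w} // z ∈ x.powerset} :=
    ⟨_, hU.powerset_mem hx, ⟨Equiv.refl _⟩⟩
  refine hT.of_injective hU (fun S => ⟨x.sep (fun z => ∃ a ∈ S, (e a : ZFSet) = z),
    ZFSet.mem_powerset.2 ZFSet.sep_subset⟩) ?_
  have key (S : Set X) (a : X) :
      a ∈ S ↔ (e a : ZFSet) ∈ x.sep (fun z => ∃ a ∈ S, (e a : ZFSet) = z) := by
    rw [ZFSet.mem_sep]
    refine ⟨fun h => ⟨(e a).2, a, h, rfl⟩, ?_⟩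
    rintro ⟨-, b, hb, h⟩
    obtain rfl : b = a := e.injective (Subtype.ext h)
    exact hb
  intro S T h
  replace h := congr_arg Subtype.val h
  dsimp only at h
  ext a
  rw [key S, key T, h]

lemma isUSet_of_hasCardinalLT (hU : IsUniverse U) {κ : Cardinal.{w}} (hκ : κ.ord.toZFSet ∈ U)
    {X : Type u} (hX : HasCardinalLT X κ) : IsUSet U X := by
  have hT : IsUSet U {z : ZFSet.{w} // z ∈ κ.ord.toZFSet} := ⟨_, hκ, ⟨Equiv.refl _⟩⟩
  have h : Cardinal.lift.{w + 1} (Cardinal.mk X) ≤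
      Cardinal.lift.{u} (Cardinal.mk {z : ZFSet.{w} // z ∈ κ.ord.toZFSet}) := by
    have h' : Cardinal.mk {z : ZFSet.{w} // z ∈ κ.ord.toZFSet} = Cardinal.lift.{w + 1} κ := by
      simpa using ZFSet.cardinalMk_coe_sort (x := κ.ord.toZFSet)
    have := Cardinal.lift_le.{w + 1}.2 (le_of_lt hX)
    rw [Cardinal.lift_lift, Cardinal.lift_lift] at this
    rw [h', Cardinal.lift_lift]
    exact this
  obtain ⟨f⟩ := Cardinal.lift_mk_le'.1 h
  exact hT.of_injective hU f f.injective

lemma IsUSmall.mono {U' : ZFSet.{w}} (h : U ⊆ U') {J : Type u} [Category.{v} J]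
    (hJ : IsUSmall U J) : IsUSmall U' J :=
  ⟨hJ.obj.mono h, hJ.mor.mono h⟩

lemma IsUSmall.hom (hU : IsUniverse U) {J : Type u} [Category.{v} J]
    (hJ : IsUSmall U J) (X Y : J) : IsUSet U (X ⟶ Y) :=
  hJ.mor.of_injective hU Arrow.mk (fun _ _ h => Arrow.mk_injective _ _ h)

lemma isUSmall_of_hom (hU : IsUniverse U) {J : Type u} [Category.{v} J] (hJ : IsUSet U J)
    (h : ∀ X Y : J, IsUSet U (X ⟶ Y)) : IsUSmall U J where
  obj := hJ
  mor := (IsUSet.sigma hU hJ (fun X => IsUSet.sigma hU hJ (fun Y => h X Y))).of_surjective hU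
    (fun p => Arrow.mk p.2.2) (fun f => ⟨⟨f.left, f.right, f.hom⟩, rfl⟩)

lemma isUSmall_of_hasCardinalLT (hU : IsUniverse U) {κ : Cardinal.{w}} (hκ : κ.ord.toZFSet ∈ U)
    {J : Type u} [Category.{v} J] (hJ : HasCardinalLT (Arrow J) κ) : IsUSmall U J where
  obj := isUSet_of_hasCardinalLT hU hκ (hasCardinalLT_of_hasCardinalLT_arrow hJ)
  mor := isUSet_of_hasCardinalLT hU hκ hJ

/-- A `U`-small category is equivalent to a `U`-small category in `Type w`. -/
lemma IsUSmall.exists_equivalence (hU : IsUniverse U) {J : Type u} [Category.{v} J]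
    (hJ : IsUSmall U J) :
    ∃ (J' : Type w) (_ : SmallCategory J') (_ : J' ≌ J), IsUSmall U J' := by
  have := hJ.mor.small
  have := small_of_small_arrow.{w} J
  have := locallySmall_of_small_arrow.{w} J
  refine ⟨ShrinkHoms (Shrink.{w} J), inferInstance,
    ((Shrink.equivalence.{w} J).trans (ShrinkHoms.equivalence.{w} (Shrink.{w} J))).symm, ?_, ?_⟩
  · exact hJ.obj.of_injective hU (equivShrink J).symm (Equiv.injective _)
  · exact hJ.mor.of_injective hU _ ((Arrow.shrinkHomsEquiv _).trans
      (Arrow.shrinkEquiv _)).injective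

end Sets

/-! ### Compact objects and generation by them. -/

section Compact

variable {U : ZFSet.{w}} {κ : Cardinal.{w}} [Fact κ.IsRegular] {C : Type u} [Category.{v} C]

section

variable {A : C} (hA : isCompact U κ C A) {J : Type w} [SmallCategory J] (hJ : IsUSmall U J)
  [IsCardinalFiltered J κ] {F : J ⥤ C} {c : Cocone F} (hc : IsColimit c)

include hA hJ hc

lemma isCompact.exists_fac (f : A ⟶ c.pt) :
    ∃ (j : J) (g : A ⟶ F.obj j), g ≫ c.ι.app j = f := by
  have := hA J hJ inferInstance
  exact Types.jointly_surjective_of_isColimit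
    (isColimitOfPreserves (coyoneda.obj (Opposite.op A)) hc) f

lemma isCompact.exists_eq {j : J} (f g : A ⟶ F.obj j) (h : f ≫ c.ι.app j = g ≫ c.ι.app j) :
    ∃ (j' : J) (a : j ⟶ j'), f ≫ F.map a = g ≫ F.map a := by
  have := hA J hJ inferInstance
  have := isFiltered_of_isCardinalFiltered J κ
  exact (Types.FilteredColimit.isColimit_eq_iff'
    (isColimitOfPreserves (coyoneda.obj (Opposite.op A)) hc) f g).1 h

lemma isCompact.exists_fac₂ (f f' : A ⟶ c.pt) :
    ∃ (j : J) (g g' : A ⟶ F.obj j), g ≫ c.ι.app j = f ∧ g' ≫ c.ι.app j = f' := by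
  have := isFiltered_of_isCardinalFiltered J κ
  obtain ⟨j, g, rfl⟩ := hA.exists_fac hJ hc f
  obtain ⟨j', g', rfl⟩ := hA.exists_fac hJ hc f'
  exact ⟨IsFiltered.max j j', g ≫ F.map (IsFiltered.leftToMax j j'),
    g' ≫ F.map (IsFiltered.rightToMax j j'), by simp, by simp⟩

end

variable (U κ) in
/-- A property of objects `G` generates `C` if it consists of compact objects and every object is
a colimit of a `U`-small `κ`-filtered diagram of objects satisfying `G`. -/
structure IsGenerating (G : ObjectProperty C) : Prop where
  compact : ∀ X, G X → isCompact U κ C X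
  exists_colimit : ∀ B : C, ∃ (J : Type w) (_ : SmallCategory J), IsUSmall U J ∧
    IsCardinalFiltered J κ ∧ G.colimitsOfShape J B

lemma IsAccessibleUCategory.isGenerating (hC : IsAccessibleUCategory U κ C) :
    IsGenerating U κ (isCompact U κ C) := by
  obtain ⟨G, -, h, h'⟩ := hC.exists_generator
  refine ⟨fun _ h => h, fun B => ?_⟩
  obtain ⟨J, _, hJ, hJ', hB⟩ := h' B
  exact ⟨J, _, hJ, hJ', G.colimitsOfShape_monotone J h _ hB⟩

variable {G : ObjectProperty C} (hG : IsGenerating U κ G)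
include hG

lemma IsGenerating.hom_ext {B Y : C} (f g : B ⟶ Y)
    (h : ∀ (X : C) (_ : G X) (p : X ⟶ B), p ≫ f = p ≫ g) : f = g := by
  obtain ⟨J, _, -, -, ⟨p⟩⟩ := hG.exists_colimit B
  exact p.isColimit.hom_ext (fun j => h _ (p.prop_diag_obj j) _)

/-- Objects of `C` are canonical colimits of the objects of a generating property. -/
lemma IsGenerating.exists_desc {B Y : C} (φ : ∀ (X : C) (_ : G X), (X ⟶ B) → (X ⟶ Y))
    (hφ : ∀ (X X' : C) (hX : G X) (hX' : G X') (a : X ⟶ X') (p : X' ⟶ B),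
      φ X hX (a ≫ p) = a ≫ φ X' hX' p) :
    ∃ f : B ⟶ Y, ∀ (X : C) (hX : G X) (p : X ⟶ B), p ≫ f = φ X hX p := by
  obtain ⟨J, _, hJ, _, ⟨p⟩⟩ := hG.exists_colimit B
  let s : Cocone p.diag := Cocone.mk Y
    { app j := φ _ (p.prop_diag_obj j) (p.ι.app j)
      naturality j j' a := by
        have h := p.ι.naturality a
        simp only [Functor.const_obj_obj, Functor.const_obj_map, Category.comp_id] at h ⊢
        rw [← hφ, h] }
  refine ⟨p.isColimit.desc s, fun X hX q => ?_⟩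
  obtain ⟨j, g, hg⟩ := (hG.compact X hX).exists_fac hJ p.isColimit q
  have h := p.isColimit.fac s j
  rw [← hg, Category.assoc, h]
  exact (hφ _ _ _ _ _ _).symm

end Compact

/-! ### Full faithfulness and preservation of limits. -/

section Extension

variable {U U' : ZFSet.{w}} {κ : Cardinal.{w}} [Fact κ.IsRegular]
  {C : Type u} [Category.{v} C] {C' : Type u'} [Category.{v'} C'] {i : C ⥤ C'}
  (hi : IsAccessibleExtension U U' κ i)
include hi

lemma IsAccessibleExtension.exists_map_eq_of_compact {X Y : C} (hX : isCompact U κ C X)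
    (hY : isCompact U κ C Y) (f : i.obj X ⟶ i.obj Y) : ∃ g : X ⟶ Y, i.map g = f := by
  have := hi.full
  obtain ⟨g, hg⟩ := (compactFunctor U U' κ i hi.map_compact).map_surjective
    (X := ⟨X, hX⟩) (Y := ⟨Y, hY⟩) (ObjectProperty.homMk (by exact f))
  exact ⟨g.hom, by
    have := congr_arg (fun h => h.hom) hg
    exact this⟩

lemma IsAccessibleExtension.map_injective_of_compact {X Y : C} (hX : isCompact U κ C X)
    (hY : isCompact U κ C Y) {f g : X ⟶ Y} (h : i.map f = i.map g) : f = g := by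
  have := hi.faithful
  have := (compactFunctor U U' κ i hi.map_compact).map_injective
    (X := ⟨X, hX⟩) (Y := ⟨Y, hY⟩) (a₁ := ObjectProperty.homMk f) (a₂ := ObjectProperty.homMk g)
    (by ext; exact h)
  exact congr_arg InducedCategory.Hom.hom this

lemma IsAccessibleExtension.exists_iso {X : C'} (hX : isCompact U' κ C' X) :
    ∃ K : C, isCompact U κ C K ∧ Nonempty (i.obj K ≅ X) := by
  have := hi.essSurj
  let F := compactFunctor U U' κ i hi.map_compact
  exact ⟨(F.objPreimage ⟨X, hX⟩).obj, (F.objPreimage ⟨X, hX⟩).property,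
    ⟨(isCompact U' κ C').ι.mapIso (F.objObjPreimageIso ⟨X, hX⟩)⟩⟩

variable (hUU' : U ⊆ U')
include hUU'

/-- Write `Y` as a `κ`-filtered colimit of compacts; `i` preserves it, and its shape is also
`U'`-small, so compactness of `i X` moves `f` to a stage where both ends are compact. -/
lemma IsAccessibleExtension.exists_map_eq_of_compact_left {X Y : C} (hX : isCompact U κ C X)
    (f : i.obj X ⟶ i.obj Y) : ∃ g : X ⟶ Y, i.map g = f := by
  obtain ⟨J, _, hJ, _, ⟨p⟩⟩ := hi.source.isGenerating.exists_colimit Y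
  have := hi.accessibleFunctor.preserves J hJ inferInstance
  obtain ⟨j, g, hg⟩ := (hi.map_compact X hX).exists_fac (hJ.mono hUU')
    (isColimitOfPreserves i p.isColimit) f
  obtain ⟨g, rfl⟩ := hi.exists_map_eq_of_compact hX (p.prop_diag_obj j) g
  exact ⟨g ≫ p.ι.app j, by rw [i.map_comp]; exact hg⟩

lemma IsAccessibleExtension.functor_faithful : i.Faithful where
  map_injective {A Y} f g h := by
    refine hi.source.isGenerating.hom_ext _ _ (fun X hX q => ?_)
    obtain ⟨J, _, hJ, _, ⟨p⟩⟩ := hi.source.isGenerating.exists_colimit Y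
    have := hi.accessibleFunctor.preserves J hJ inferInstance
    obtain ⟨j, a, b, ha, hb⟩ := hX.exists_fac₂ hJ p.isColimit (q ≫ f) (q ≫ g)
    obtain ⟨j', α, hα⟩ := (hi.map_compact X hX).exists_eq (hJ.mono hUU')
      (isColimitOfPreserves i p.isColimit) (i.map a) (i.map b) (by
        have := congr_arg i.map ha
        have h₂ := congr_arg i.map hb
        rw [i.map_comp] at this h₂
        refine this.trans (Eq.trans ?_ h₂.symm)
        rw [i.map_comp, i.map_comp, h])
    have hab : a ≫ p.diag.map α = b ≫ p.diag.map α :=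
      hi.map_injective_of_compact hX (p.prop_diag_obj j') (by
        rw [i.map_comp, i.map_comp]
        exact hα)
    rw [← ha, ← hb]
    have h := p.cocone.w α
    rw [← h, reassoc_of% hab]

lemma IsAccessibleExtension.functor_full : i.Full where
  map_surjective {A Y} f := by
    have := hi.functor_faithful hUU'
    -- Lift `f` on each compact over `A`; faithfulness makes the lifts compatible, so they glue.
    choose φ hφ using fun (X : C) (hX : isCompact U κ C X) (q : X ⟶ A) =>
      hi.exists_map_eq_of_compact_left hUU' hX (i.map q ≫ f)
    obtain ⟨g, hg⟩ := hi.source.isGenerating.exists_desc φ (fun X X' hX hX' a p =>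
      i.map_injective (by simp [hφ]))
    refine ⟨g, ?_⟩
    obtain ⟨J, _, hJ, _, ⟨p⟩⟩ := hi.source.isGenerating.exists_colimit A
    have := hi.accessibleFunctor.preserves J hJ inferInstance
    refine (isColimitOfPreserves i p.isColimit).hom_ext (fun j => ?_)
    have h := hφ _ (p.prop_diag_obj j) (p.ι.app j)
    rw [← hg, i.map_comp] at h
    exact h

lemma IsAccessibleExtension.preservesLimit {J : Type u''} [Category.{v''} J] (B : J ⥤ C) :
    PreservesLimit B i where
  preserves {c} hc := ⟨by
    have := hi.functor_faithful hUU'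
    have := hi.functor_full hUU'
    -- For a compact test object, replace it by some `i K` and pull the cone back to `C`.
    have key (X : C') (hX : isCompact U' κ C' X) (s : Cone (B ⋙ i)) (q : X ⟶ s.pt) :
        ∃ l : X ⟶ i.obj c.pt, ∀ j, l ≫ i.map (c.π.app j) = q ≫ s.π.app j := by
      obtain ⟨K, -, ⟨e⟩⟩ := hi.exists_iso hX
      let t : Cone B := Cone.mk K
        { app j := i.preimage (e.hom ≫ q ≫ s.π.app j)
          naturality j j' a := i.map_injective (by
            have := s.w a
            simp only [Functor.comp_map] at this
            simp [this]) }
      refine ⟨e.inv ≫ i.map (hc.lift t), fun j => ?_⟩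
      rw [Category.assoc, ← i.map_comp, hc.fac]
      simp [t]
    have uniq (X : C') (hX : isCompact U' κ C' X) (l l' : X ⟶ i.obj c.pt)
        (h : ∀ j, l ≫ i.map (c.π.app j) = l' ≫ i.map (c.π.app j)) : l = l' := by
      obtain ⟨K, -, ⟨e⟩⟩ := hi.exists_iso hX
      rw [← cancel_epi e.hom, ← i.map_preimage (e.hom ≫ l), ← i.map_preimage (e.hom ≫ l')]
      congr 1
      exact hc.hom_ext (fun j => i.map_injective (by simp [h]))
    have hG := hi.target.isGenerating
    choose φ hφ using key
    have ex (s : Cone (B ⋙ i)) : ∃ l : s.pt ⟶ i.obj c.pt,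
        ∀ j, l ≫ i.map (c.π.app j) = s.π.app j := by
      obtain ⟨l, hl⟩ := hG.exists_desc (fun X hX q => φ X hX s q)
        (fun X X' hX hX' a p => uniq X hX _ _ (fun j => by simp [hφ]))
      exact ⟨l, fun j => hG.hom_ext _ _ (fun X hX p => by rw [reassoc_of% hl _ hX p, hφ])⟩
    choose l hl using ex
    exact
      { lift := l
        fac := hl
        uniq s m hm := hG.hom_ext _ _ (fun X hX p => uniq X hX _ _ (fun j => by
          have := hm j
          dsimp at this
          rw [Category.assoc, Category.assoc, hl, this])) }⟩

end Extension

/-! ### From colimits of fewer than `κ` compacts to all `U`-small colimits. -/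

section Cocompleteness

/-- `C` has colimits for all diagrams of `(κ, U)`-compact objects with less than `κ` arrows. -/
def HasColimitsOfCompacts (U : ZFSet.{w}) (κ : Cardinal.{w}) [Fact κ.IsRegular]
    (C : Type u) [Category.{v} C] : Prop :=
  ∀ (J : Type w) [SmallCategory J], HasCardinalLT (Arrow J) κ → ∀ D : J ⥤ C,
    (∀ j, isCompact U κ C (D.obj j)) → HasColimit D

variable {U : ZFSet.{w}} {κ : Cardinal.{w}} [Fact κ.IsRegular] {C : Type u} [Category.{v} C]

/-- The objects which are the source or the target of an arrow in `T`. -/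
def endpoints {E : Type u} [Category.{v} E] (T : Set (Arrow E)) : Set E :=
  (fun a => a.left) '' T ∪ (fun a => a.right) '' T

section

variable {E : Type u} [Category.{v} E]

lemma left_mem_endpoints {T : Set (Arrow E)} {a : Arrow E} (ha : a ∈ T) : a.left ∈ endpoints T :=
  Or.inl ⟨a, ha, rfl⟩

lemma right_mem_endpoints {T : Set (Arrow E)} {a : Arrow E} (ha : a ∈ T) :
    a.right ∈ endpoints T :=
  Or.inr ⟨a, ha, rfl⟩

lemma endpoints_mono {S T : Set (Arrow E)} (h : S ⊆ T) : endpoints S ⊆ endpoints T :=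
  Set.union_subset_union (Set.image_mono h) (Set.image_mono h)

lemma hasCardinalLT_endpoints {T : Set (Arrow E)} (hT : HasCardinalLT T κ) :
    HasCardinalLT (endpoints T) κ :=
  hasCardinalLT_union (Cardinal.IsRegular.aleph0_le Fact.out)
    (hT.of_surjective _ Set.imageFactorization_surjective)
    (hT.of_surjective _ Set.imageFactorization_surjective)

end

/-- The colimit of the restriction of a diagram of compact objects to less than `κ` arrows. -/
lemma HasColimitsOfCompacts.exists_colimit (hS : HasColimitsOfCompacts U κ C) {E : Type w}
    [SmallCategory E] (D : E ⥤ C) (hD : ∀ e, isCompact U κ C (D.obj e)) (T : Set (Arrow E))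
    (hT : HasCardinalLT T κ) :
    ∃ (Q : C) (q : ∀ e, e ∈ endpoints T → (D.obj e ⟶ Q)),
      (∀ (a : Arrow E) (ha : a ∈ T), q a.left (left_mem_endpoints ha) =
        D.map a.hom ≫ q a.right (right_mem_endpoints ha)) ∧
      (∀ (Y : C) (φ : ∀ e, e ∈ endpoints T → (D.obj e ⟶ Y)),
        (∀ (a : Arrow E) (ha : a ∈ T), φ a.left (left_mem_endpoints ha) =
          D.map a.hom ≫ φ a.right (right_mem_endpoints ha)) →
        ∃ l : Q ⟶ Y, ∀ e he, q e he ≫ l = φ e he) ∧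
      (∀ (Y : C) (l l' : Q ⟶ Y), (∀ e he, q e he ≫ l = q e he ≫ l') → l = l') := by
  -- `T` need not be closed under composition, so the colimit is taken as a multicoequalizer: one
  -- object per endpoint and one relation per arrow of `T`.
  let S : MultispanShape.{w, w} :=
    { L := T
      R := endpoints T
      fst a := ⟨a.1.left, left_mem_endpoints a.2⟩
      snd a := ⟨a.1.right, right_mem_endpoints a.2⟩ }
  let I : MultispanIndex S C :=
    { left a := D.obj a.1.left
      right e := D.obj e.1
      fst a := 𝟙 _
      snd a := D.map a.1.hom }
  have hκ : Cardinal.aleph0 ≤ κ := Cardinal.IsRegular.aleph0_le Fact.out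
  have hR : HasCardinalLT S.R κ := hasCardinalLT_endpoints hT
  have hL : HasCardinalLT S.L κ := hT
  have : HasMulticoequalizer I := hS _ (by
    rw [hasCardinalLT_iff_of_equiv (WalkingMultispan.arrowEquiv S),
      hasCardinalLT_sum_iff _ _ _ hκ, hasCardinalLT_sum_iff _ _ _ hκ,
      hasCardinalLT_iff_of_equiv (WalkingMultispan.equiv S), hasCardinalLT_sum_iff _ _ _ hκ]
    exact ⟨⟨hL, hR⟩, hL, hL⟩) I.multispan (by
      rintro (a | b)
      · exact hD _
      · exact hD _)
  refine ⟨multicoequalizer I, fun e he => Multicoequalizer.π I ⟨e, he⟩, fun a ha => ?_,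
    fun Y φ hφ => ⟨Multicoequalizer.desc I Y (fun e => φ e.1 e.2) (fun a => ?_), fun e he => ?_⟩,
    fun Y l l' h => Multicoequalizer.hom_ext _ _ _ (fun e => h e.1 e.2)⟩
  · have h := Multicoequalizer.condition I ⟨a, ha⟩
    exact (Category.id_comp _).symm.trans h
  · exact (Category.id_comp _).trans (hφ a.1 a.2)
  · exact Multicoequalizer.π_desc I Y (fun e => φ e.1 e.2) _ ⟨e, he⟩

open CardinalDirectedPoset in
omit [Fact κ.IsRegular] in
lemma IsUSmall.setCardinalLT (hU : IsUniverse U) {X : Type w} (hX : IsUSet U X) :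
    IsUSmall U (SetCardinalLT κ X) := by
  have h : IsUSet U (SetCardinalLT κ X) :=
    (hX.set hU).of_injective hU Subtype.val Subtype.val_injective
  exact isUSmall_of_hom hU h (fun S _ => h.of_injective hU (fun _ => S)
    (fun _ _ _ => Subsingleton.elim _ _))

open CardinalDirectedPoset in
-- Sets of fewer than `κ` arrows form a `U`-small `κ`-filtered poset; the colimit of the partial
-- colimits over it is the colimit of `D`.
lemma hasColimit_of_isCompact (hU : IsUniverse U) (hC : HasFilteredColimits U κ C)
    (hS : HasColimitsOfCompacts U κ C) {E : Type w} [SmallCategory E] (hE : IsUSmall U E)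
    (D : E ⥤ C) (hD : ∀ e, isCompact U κ C (D.obj e)) : HasColimit D := by
  choose Q q hq hl hext using fun T : SetCardinalLT κ (Arrow E) => hS.exists_colimit D hD T.1 T.2
  have hmap (S T : SetCardinalLT κ (Arrow E)) (h : S ≤ T) : ∃ l : Q S ⟶ Q T,
      ∀ e he, q S e he ≫ l = q T e (endpoints_mono h he) :=
    hl S (Q T) _ (fun a ha => hq T a (h ha))
  choose m hm using hmap
  let F : SetCardinalLT κ (Arrow E) ⥤ C :=
    { obj := Q
      map f := m _ _ (leOfHom f)
      map_id T := hext _ _ _ _ (fun e he => by rw [hm, Category.comp_id])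
      map_comp f g := hext _ _ _ _ (fun e he => by
        rw [hm, reassoc_of% hm _ _ (leOfHom f), hm]) }
  have : HasColimitsOfShape (SetCardinalLT κ (Arrow E)) C :=
    hC _ (IsUSmall.setCardinalLT hU hE.mor) inferInstance
  have hw (S T : SetCardinalLT κ (Arrow E)) (h : S ≤ T) :
      m S T h ≫ colimit.ι F T = colimit.ι F S := colimit.w F (homOfLE h)
  -- The identity arrow is a canonical set of arrows having `e` as an endpoint.
  have hmem (e : E) : e ∈ endpoints (SetCardinalLT.singleton κ (Arrow.mk (𝟙 e))).1 :=
    left_mem_endpoints (a := Arrow.mk (𝟙 e)) rfl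
  let r (e : E) : D.obj e ⟶ colimit F := q _ e (hmem e) ≫ colimit.ι F _
  have hr (T : SetCardinalLT κ (Arrow E)) (e : E) (he : e ∈ endpoints T.1) :
      q T e he ≫ colimit.ι F T = r e := by
    let S : SetCardinalLT κ (Arrow E) :=
      ⟨T.1 ∪ (SetCardinalLT.singleton κ (Arrow.mk (𝟙 e))).1,
        hasCardinalLT_union (Cardinal.IsRegular.aleph0_le Fact.out) T.2
          (SetCardinalLT.singleton κ (Arrow.mk (𝟙 e))).2⟩
    have h₁ : T ≤ S := Set.subset_union_left
    have h₂ : SetCardinalLT.singleton κ (Arrow.mk (𝟙 e)) ≤ S := Set.subset_union_right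
    dsimp only [r]
    rw [← hw _ _ h₁, ← hw _ _ h₂, reassoc_of% hm _ _ h₁, reassoc_of% hm _ _ h₂]
  let c : Cocone D := Cocone.mk (colimit F)
    { app := r
      naturality e e' a := by
        have h := hq (SetCardinalLT.singleton κ (Arrow.mk a)) (Arrow.mk a) rfl
        rw [← hr _ e (left_mem_endpoints (a := Arrow.mk a)
          (T := (SetCardinalLT.singleton κ (Arrow.mk a)).1) rfl),
          ← hr _ e' (right_mem_endpoints (a := Arrow.mk a)
          (T := (SetCardinalLT.singleton κ (Arrow.mk a)).1) rfl)]
        erw [h]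
        simp }
  choose d hd using fun (s : Cocone D) (T : SetCardinalLT κ (Arrow E)) =>
    hl T s.pt (fun e _ => s.ι.app e) (fun a _ => (s.w a.hom).symm)
  let t (s : Cocone D) : Cocone F := Cocone.mk s.pt
    { app := d s
      naturality S T f := hext _ _ _ _ (fun e he => by
        simp [F, reassoc_of% hm _ _ (leOfHom f), hd]) }
  exact ⟨⟨c, {
    desc s := colimit.desc F (t s)
    fac s e := by simp [c, r, t, hd]
    uniq s l h := colimit.hom_ext (fun T => hext _ _ _ _ (fun e he => by
      have := h e
      rw [colimit.ι_desc, hd, reassoc_of% hr T e he]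
      exact this)) }⟩⟩

/-- A `κ`-accessible `U`-category is `U`-cocomplete as soon as it has colimits of diagrams of
compact objects with less than `κ` arrows. -/
lemma IsAccessibleUCategory.isUCocomplete (hU : IsUniverse U) (hC : IsAccessibleUCategory U κ C)
    (hS : HasColimitsOfCompacts U κ C) : IsUCocomplete U C := by
  intro J _ hJ
  refine ⟨fun D => ?_⟩
  obtain ⟨G, hGset, hGc, hGe⟩ := hC.exists_generator
  have hG : IsGenerating U κ G := ⟨hGc, hGe⟩
  -- Objects of this category are generators with a map to some `D j`; the diagram of their sources
  -- has the same colimit as `D`, and consists of compacts.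
  have hE : IsUSmall U (Comma G.ι D) := by
    refine isUSmall_of_hom hU ?_ (fun X Y => ?_)
    · exact (IsUSet.sigma hU hGset (fun X => IsUSet.sigma hU hJ.obj
        (fun j => hC.locallySmall.hom X.1 (D.obj j)))).of_surjective hU
          (fun p => Comma.mk (L := G.ι) (R := D) (left := ⟨p.1.1, p.1.2⟩) (right := p.2.1)
            p.2.2) (fun X => ⟨⟨⟨X.left.1, X.left.2⟩, X.right, X.hom⟩, rfl⟩)
    · exact ((hC.locallySmall.hom X.left.1 Y.left.1).prod hU
        (hJ.hom hU X.right Y.right)).of_injective hU (fun f => (f.left.hom, f.right))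
        (fun f g h => by
          obtain ⟨h₁, h₂⟩ := Prod.ext_iff.1 h
          ext
          · exact h₁
          · exact h₂)
  obtain ⟨E, _, e, hE'⟩ := hE.exists_equivalence hU
  let K : Comma G.ι D ⥤ C := Comma.fst _ _ ⋙ G.ι
  have : HasColimit (e.functor ⋙ K) :=
    hasColimit_of_isCompact hU hC.hasFilteredColimits hS hE' _
      (fun x => hGc _ (e.functor.obj x).left.2)
  have : HasColimit K := hasColimit_of_equivalence_comp e
  let φ (j : J) (X : C) (hX : G X) (p : X ⟶ D.obj j) : X ⟶ colimit K :=
    colimit.ι K (Comma.mk (L := G.ι) (R := D) (left := ⟨X, hX⟩) (right := j) p)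
  have hφ (j j' : J) (X X' : C) (hX : G X) (hX' : G X') (a : X ⟶ X') (b : j ⟶ j')
      (p : X ⟶ D.obj j) (p' : X' ⟶ D.obj j') (h : a ≫ p' = p ≫ D.map b) :
      φ j X hX p = a ≫ φ j' X' hX' p' := by
    let f : Comma.mk (L := G.ι) (R := D) (left := ⟨X, hX⟩) (right := j) p ⟶
      Comma.mk (L := G.ι) (R := D) (left := ⟨X', hX'⟩) (right := j') p' :=
      { left := ObjectProperty.homMk a, right := b, w := h }
    exact (colimit.w K f).symm
  choose r hr using fun j => hG.exists_desc (φ j)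
    (fun X X' hX hX' a p => hφ j j X X' hX hX' a (𝟙 j) _ _ (by simp))
  let c : Cocone D := Cocone.mk (colimit K)
    { app := r
      naturality j j' b := hG.hom_ext _ _ (fun X hX p => by
        have := hφ j j' X X hX hX (𝟙 X) b p (p ≫ D.map b) (by simp)
        rw [Category.id_comp] at this
        rw [← Category.assoc, hr _ X hX, ← this, ← hr _ X hX]
        simp) }
  let t (s : Cocone D) : Cocone K := Cocone.mk s.pt
    { app X := X.hom ≫ s.ι.app X.right
      naturality X Y f := by
        have h := f.w
        have h' := s.w f.right
        dsimp at h h'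
        change f.left.hom ≫ Y.hom ≫ _ = (X.hom ≫ s.ι.app X.right) ≫ 𝟙 _
        rw [← Category.assoc, h, Category.comp_id, Category.assoc, h'] }
  exact ⟨⟨c, {
    desc s := colimit.desc K (t s)
    fac s j := hG.hom_ext _ _ (fun X hX p => by
      rw [reassoc_of% hr j X hX p]
      exact colimit.ι_desc _ _)
    uniq s l h := colimit.hom_ext (fun X => by
      have h₁ := h X.right
      have h₂ := hr X.right X.left.1 X.left.2 X.hom
      rw [colimit.ι_desc]
      change colimit.ι K X ≫ l = X.hom ≫ s.ι.app X.right
      rw [← h₁]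
      change φ X.right X.left.1 X.left.2 X.hom ≫ l = _
      rw [← h₂, Category.assoc]) }⟩⟩

end Cocompleteness

/-! ### Colimits of fewer than `κ` compact objects. -/

section SmallColimits

variable {U : ZFSet.{w}} {κ : Cardinal.{w}} [Fact κ.IsRegular] {C : Type u} [Category.{v} C]
  {K : Type w} [SmallCategory K] (hK : HasCardinalLT (Arrow K) κ) {D : K ⥤ C}
  (hD : ∀ k, isCompact U κ C (D.obj k))
include hK hD

/-- Maps out of the colimit form a limit of size less than `κ` of hom-sets, which commutes with
`κ`-filtered colimits of types. -/
lemma isCompact_of_isColimit {c : Cocone D} (hc : IsColimit c) : isCompact U κ C c.pt := by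
  intro J _ hJ _
  refine ⟨fun {X} => ⟨fun {cX} hcX => ⟨?_⟩⟩⟩
  have h (k : Kᵒᵖ) : IsColimit (((D.op ⋙ coyoneda).obj k).mapCocone cX) :=
    have := hD k.unop J hJ inferInstance
    isColimitOfPreserves (coyoneda.obj (Opposite.op (D.obj k.unop))) hcX
  exact Functor.Accessible.Limits.isColimitMapCocone (F := D.op ⋙ coyoneda)
    (coyoneda.mapCone c.op) (fun Y => isLimitOfPreserves (yoneda.obj Y) hc.op) κ (by simpa) cX h

/-- A cocone under a diagram of compact objects with less than `κ` arrows whose point is a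
`κ`-filtered colimit factors through a stage of this colimit. -/
lemma exists_natTrans_fac {J : Type w} [SmallCategory J] (hJ : IsUSmall U J)
    [IsCardinalFiltered J κ] {F : J ⥤ C} {c : Cocone F} (hc : IsColimit c)
    (σ : D ⟶ (Functor.const K).obj c.pt) :
    ∃ (j : J) (τ : D ⟶ (Functor.const K).obj (F.obj j)),
      ∀ k, τ.app k ≫ c.ι.app j = σ.app k := by
  have hK' := hasCardinalLT_of_hasCardinalLT_arrow hK
  choose j g hg using fun k => (hD k).exists_fac hJ hc (σ.app k)
  let g' (k : K) : D.obj k ⟶ F.obj (IsCardinalFiltered.max j hK') :=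
    g k ≫ F.map (IsCardinalFiltered.toMax j hK' k)
  have hg' (k : K) : g' k ≫ c.ι.app _ = σ.app k := by
    simp only [g', Category.assoc, c.w, hg]
  -- Each naturality equation holds at a later stage; there are fewer than `κ` of them, so one stage
  -- serves for all.
  choose j' α hα using fun f : Arrow K => (hD f.left).exists_eq hJ hc
    (D.map f.hom ≫ g' f.right) (g' f.left) (by
      rw [Category.assoc, hg' f.right, hg' f.left]
      simp)
  obtain ⟨m, a, b, hb⟩ := IsCardinalFiltered.wideSpan α hK
  refine ⟨m, { app k := g' k ≫ F.map b, naturality k k' f := ?_ }, fun k => ?_⟩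
  · have h : (D.map f ≫ g' k') ≫ F.map b = g' k ≫ F.map b := by
      rw [← hb (Arrow.mk f), F.map_comp, ← Category.assoc (D.map f ≫ g' k')]
      exact (hα (Arrow.mk f) =≫ _).trans (Category.assoc _ _ _)
    exact (Category.assoc _ _ _).symm.trans (h.trans (Category.comp_id _).symm)
  · rw [Category.assoc, c.w, hg']

end SmallColimits

/-! ### Transfer of colimits of compacts along the extension. -/

section Extension

variable {U U' : ZFSet.{w}} {κ : Cardinal.{w}} [Fact κ.IsRegular]
  {C : Type u} [Category.{v} C] {C' : Type u'} [Category.{v'} C'] {i : C ⥤ C'}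
  (hi : IsAccessibleExtension U U' κ i) (hUU' : U ⊆ U')
include hi hUU'

/-- The colimit formed in `C'` is again compact, hence comes from `C`, and fully faithful functors
create such colimits. -/
lemma IsAccessibleExtension.hasColimitsOfCompacts_source (h : HasColimitsOfCompacts U' κ C') :
    HasColimitsOfCompacts U κ C := by
  intro K _ hK D hD
  have := hi.functor_faithful hUU'
  have := hi.functor_full hUU'
  have hD' (k : K) : isCompact U' κ C' ((D ⋙ i).obj k) := hi.map_compact _ (hD k)
  have := h K hK (D ⋙ i) hD'
  obtain ⟨L, -, ⟨e⟩⟩ := hi.exists_iso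
    (isCompact_of_isColimit hK hD' (colimit.isColimit (D ⋙ i)))
  have := createsColimitOfFullyFaithfulOfIso (K := D) (F := i) L e
  exact hasColimit_of_created D i

/-- Any target is a `κ`-filtered colimit of objects in the essential image of `i`. A cocone, or an
equality of two maps, already lives at one stage, where full faithfulness returns it to `C`. -/
lemma IsAccessibleExtension.preservesColimit_of_compact {K : Type w} [SmallCategory K]
    (hK : HasCardinalLT (Arrow K) κ) {D : K ⥤ C} (hD : ∀ k, isCompact U κ C (D.obj k)) :
    PreservesColimit D i where
  preserves {c} hc := ⟨by
    have := hi.functor_faithful hUU'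
    have := hi.functor_full hUU'
    have hD' (k : K) : isCompact U' κ C' ((D ⋙ i).obj k) := hi.map_compact _ (hD k)
    have hc' : isCompact U' κ C' (i.obj c.pt) :=
      hi.map_compact _ (isCompact_of_isColimit hK hD hc)
    have ex (s : Cocone (D ⋙ i)) :
        ∃ l : i.obj c.pt ⟶ s.pt, ∀ k, i.map (c.ι.app k) ≫ l = s.ι.app k := by
      obtain ⟨J, _, hJ, _, ⟨p⟩⟩ := hi.target.isGenerating.exists_colimit s.pt
      obtain ⟨j, τ, hτ⟩ := exists_natTrans_fac hK hD' hJ p.isColimit s.ι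
      obtain ⟨Y, -, ⟨e⟩⟩ := hi.exists_iso (p.prop_diag_obj j)
      let t : Cocone D := Cocone.mk Y
        { app k := i.preimage (τ.app k ≫ e.inv)
          naturality k k' f := i.map_injective (by
            have := τ.naturality f
            simp only [Functor.comp_map, Functor.const_obj_map] at this
            simp [reassoc_of% this]) }
      refine ⟨i.map (hc.desc t) ≫ e.hom ≫ p.ι.app j, fun k => ?_⟩
      rw [← hτ, ← Category.assoc, ← i.map_comp, hc.fac]
      simp [t]
    have uniq (Y : C') (l l' : i.obj c.pt ⟶ Y)
        (h : ∀ k, i.map (c.ι.app k) ≫ l = i.map (c.ι.app k) ≫ l') : l = l' := by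
      obtain ⟨J, _, hJ, _, ⟨p⟩⟩ := hi.target.isGenerating.exists_colimit Y
      obtain ⟨j, a, b, rfl, rfl⟩ := hc'.exists_fac₂ hJ p.isColimit l l'
      choose j' α hα using fun k => (hD' k).exists_eq hJ p.isColimit
        (i.map (c.ι.app k) ≫ a) (i.map (c.ι.app k) ≫ b) (by simpa using h k)
      obtain ⟨m, β, γ, hγ⟩ :=
        IsCardinalFiltered.wideSpan α (hasCardinalLT_of_hasCardinalLT_arrow hK)
      obtain ⟨Z, -, ⟨e⟩⟩ := hi.exists_iso (p.prop_diag_obj m)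
      have hab : a ≫ p.diag.map γ = b ≫ p.diag.map γ := by
        rw [← cancel_mono e.inv, ← i.map_preimage ((a ≫ p.diag.map γ) ≫ e.inv),
          ← i.map_preimage ((b ≫ p.diag.map γ) ≫ e.inv)]
        congr 1
        refine hc.hom_ext (fun k => i.map_injective ?_)
        have := hα k
        simp only [Category.assoc] at this
        simp [← hγ k, reassoc_of% this]
      rw [← p.cocone.w γ, reassoc_of% hab]
    choose l hl using ex
    exact
      { desc := l
        fac := hl
        uniq s m hm := uniq _ _ _ (fun k => (hm k).trans (hl s k).symm) }⟩

lemma IsAccessibleExtension.hasColimitsOfCompacts_target (h : HasColimitsOfCompacts U κ C) :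
    HasColimitsOfCompacts U' κ C' := by
  intro K _ hK D' hD'
  have := hi.functor_faithful hUU'
  have := hi.functor_full hUU'
  choose X hX e using fun k => hi.exists_iso (hD' k)
  -- Transport `D'` to `C` through the chosen isomorphisms.
  let D : K ⥤ C :=
    { obj := X
      map {k k'} f := i.preimage ((e k).some.hom ≫ D'.map f ≫ (e k').some.inv)
      map_id k := i.map_injective (by simp)
      map_comp f g := i.map_injective (by simp) }
  have := h K hK D hX
  have := hi.preservesColimit_of_compact hUU' hK hX (D := D)
  let e' : D' ≅ D ⋙ i := NatIso.ofComponents (fun k => (e k).some.symm) (by simp [D])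
  exact hasColimit_of_iso e'

end Extension

lemma IsUCocomplete.hasColimitsOfCompacts {U : ZFSet.{w}} {κ : Cardinal.{w}} [Fact κ.IsRegular]
    (hU : IsUniverse U) (hκ : κ.ord.toZFSet ∈ U) {C : Type u} [Category.{v} C]
    (h : IsUCocomplete U C) : HasColimitsOfCompacts U κ C := by
  intro K _ hK D _
  have := h K (isUSmall_of_hasCardinalLT hU hκ hK)
  infer_instance

end UniverseEnlargement

theorem mainTheorem4
    (U U' : ZFSet.{w}) (hU : UniverseEnlargement.IsUniverse U)
    (hU' : UniverseEnlargement.IsUniverse U') (hUU' : U ⊆ U')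
    (κ : Cardinal.{w}) [Fact κ.IsRegular] (hκ : κ.ord.toZFSet ∈ U)
    {C : Type u} [Category.{v} C] {C' : Type u'} [Category.{v'} C'] (i : C ⥤ C')
    (hi : UniverseEnlargement.IsAccessibleExtension U U' κ i) :
    (UniverseEnlargement.IsLocallyPresentableUCategory U κ C ↔
      UniverseEnlargement.IsLocallyPresentableUCategory U' κ C') ∧
    (i.Full ∧ i.Faithful) ∧
    (∀ (J : Type u'') [Category.{v''} J] (B : J ⥤ C), PreservesLimit B i) := by
  refine ⟨⟨fun h => ⟨hi.target, ?_⟩, fun h => ⟨hi.source, ?_⟩⟩,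
    ⟨hi.functor_full hUU', hi.functor_faithful hUU'⟩, fun J _ B => hi.preservesLimit hUU' B⟩
  · exact hi.target.isUCocomplete hU' (hi.hasColimitsOfCompacts_target hUU'
      (h.cocomplete.hasColimitsOfCompacts hU hκ))
  · exact hi.source.isUCocomplete hU (hi.hasColimitsOfCompacts_source hUU'
      (h.cocomplete.hasColimitsOfCompacts hU' (hUU' hκ)))
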